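/- Let $b=(b_1,b_2)\in\mathbb{R}^2\setminus\mathbb{Z}^2$ with $-1\le b_2\le b_1\le 0$, let $S=\mathbb{Z}^2+b$, and let $\gamma_1,\gamma_2,\gamma_3>0$ with $\gamma_2,\gamma_3<1$. Put $d_1=(1,\gamma_1)\cdot(b_1+1,b_2+1)$, $d_2=(-1,\gamma_2)\cdot(b_1,b_2+1)$, $d_3=(\gamma_3,-1)\cdot(b_1,b_2)$ (these are positive), $\omega^1=\frac{1}{d_1}(1,\gamma_1)$, $\omega^2=\frac1{d_2}(-1,\gamma_2)$, $\omega^3=\frac1{d_3}(\gamma_3,-1)$, let $T=T(\gamma_1,\gamma_2,\gamma_3)=\{x\in\mathbb{R}^2:\omega^i\cdot x\le 1,\ i=1,2,3\}$ be the Type 3 triangle, let $\psi(r)=\max_i\omega^i\cdot r$, and let $P\subset\mathbb{R}^3$ be the set of $(x_1,x_2,x_3)$ with $$\omega^1\cdot(x_1,x_2)+\Bigl(1-\tfrac{(1,\gamma_1)\cdot(b_1+1,b_2+2)}{d_1}\Bigr)x_3\le 1,\qquad \omega^2\cdot(x_1,x_2)\le 1,\qquad \omega^3\cdot(x_1,x_2)+\Bigl(\tfrac12-\tfrac{(\gamma_3,-1)\cdot(b_1+1,b_2+2)}{2d_3}\Bigr)x_3\le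 1 .$$ Definitions. A pair of functions $\psi,\pi:\mathbb{R}^2\to\mathbb{R}$ is a *cut-generating pair* for $S$ if for all $k,\ell\in\mathbb{Z}_+$ with $k+\ell>0$ and all real matrices $R$ ($2\times k$) and $Q$ ($2\times\ell$), the inequality $\sum_r\psi(r)s_r+\sum_q\pi(q)y_q\ge1$ (sums over the columns of $R$ and $Q$) holds on the convex hull of $\{(s,y)\in\mathbb{R}_+^k\times\mathbb{Z}_+^\ell: Rs+Qy\in S\}$; then $\pi$ is a *lifting* of $\psi$, and a *minimal lifting* is a pointwise minimal one. For $p\in\mathbb{R}^2$ let $V_\psi(p)=\inf\{\pi(p):\pi\text{ a minimal lifting of }\psi\}$, let $\mathcal{L}_{\psi,p}$ be the set of minimal liftings $\pi$ with $\pi(p)=V_\psi(p)$, and let the *fixing region* $\mathcal{F}_{\psi,p}$ be the set of points at which all members of $\mathcal{L}_{\psi,p}$ agree. Let $W_S=\{w: s+mw\in S\ \forall s\in S,\ m\in\mathbb{Z}\}$ $(=\mathbb{Z}^2)$. For $\lambda\in\mathbb{R}$ let $B(\lambda,p)=\{(r,t)\in\mathbb{R}^2\times\mathbb{R}:\omega^i\cdot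 r+(\lambda-\omega^i\cdot p)t\le1,\ i=1,2,3\}$. For $x\in\mathbb{R}^2$, let $R_T(x)=\{r:(\omega^i-\omega^k)\cdot r\le0,\ (\omega^i-\omega^k)\cdot(x-r)\le0\ \forall i\}$, where $k$ is any index with $\psi(x)=\omega^k\cdot x$, and let $$\mathcal{X}(T,p)=\bigcup_{(x,N)\in B(V_\psi(p),p)\cap(S\times\mathbb{Z}_+)}\ \bigcup_{i=0}^{N}\bigl(R_T(x-Np)+ip\bigr).$$ A set is *$S\times\mathbb{Z}_+$-free* if its interior contains no point of $S\times\mathbb{Z}_+$. A *translated cone with apex $a$* is a set $a+C$ with $C$ a convex cone that contains $0$ and no line. Then: (i) $P$ is a translated cone with an apex $a^*=(a_1^*,a_2^*,a_3^*)$ such that $a_3^*>0$ if and only if $\gamma_2(2-\gamma_3+2\gamma_1\gamma_3)-\gamma_1\gamma_3>0$. (ii) If $P$ is $S\times\mathbb{Z}_+$-free, then $P$ is a translated cone with an apex $a^*$ such that $a_3^*>0$, and for $p^*=\frac1{a_3^*}(a_1^*,a_2^*)$ one has $\mathcal{X}(T,p^*)+W_S=\mathbb{R}^2$, and $\mathcal{L}_{\psi,p^*}$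 consists of exactly one lifting; in particular $\mathcal{F}_{\psi,p^*}=\mathbb{R}^2$, i.e. $T$ is one point fixable. -/

import Mathlib

open Matrix
open scoped Pointwise

noncomputable section

namespace CutGen

/-- The mixed-integer set `X_S(R,P)` of all `(s,y)` with `s` nonnegative real, `y` nonnegative
integral (its entries are regarded as real numbers), and `R s + P y ∈ S`. -/
def mixedIntSet {n : ℕ} (S : Set (Fin n → ℝ)) {k l : ℕ}
    (R : Matrix (Fin n) (Fin k) ℝ) (P : Matrix (Fin n) (Fin l) ℝ) :
    Set ((Fin k → ℝ) × (Fin l → ℝ)) :=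
  {q | (∀ j, 0 ≤ q.1 j) ∧ (∀ j, ∃ m : ℕ, q.2 j = (m : ℝ)) ∧ R *ᵥ q.1 + P *ᵥ q.2 ∈ S}

/-- `(ψ, π)` is a valid cut-generating pair for `S`: for all `k, l` (not both zero) and all
matrices `R, P`, the inequality `∑ ψ(r) s_r + ∑ π(p) y_p ≥ 1`, summed over the columns of `R` and
of `P`, is valid for `conv (X_S(R,P))` (it is always violated by the origin). -/
def IsCutGeneratingPair {n : ℕ} (S : Set (Fin n → ℝ)) (ψ π : (Fin n → ℝ) → ℝ) : Prop :=
  ∀ (k l : ℕ), 0 < k + l →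
    ∀ (R : Matrix (Fin n) (Fin k) ℝ) (P : Matrix (Fin n) (Fin l) ℝ),
      ∀ q ∈ convexHull ℝ (mixedIntSet S R P),
        1 ≤ ∑ j, ψ (Rᵀ j) * q.1 j + ∑ j, π (Pᵀ j) * q.2 j

/-- `π` is a lifting of `ψ`. -/
def IsLifting {n : ℕ} (S : Set (Fin n → ℝ)) (ψ π : (Fin n → ℝ) → ℝ) : Prop :=
  IsCutGeneratingPair S ψ π

/-- `π` is a minimal lifting of `ψ`, with respect to pointwise dominance. -/
def IsMinimalLifting {n : ℕ} (S : Set (Fin n → ℝ)) (ψ π : (Fin n → ℝ) → ℝ) : Prop :=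
  Minimal (IsLifting S ψ) π

/-- `V_ψ(p) = inf {π(p) : π a minimal lifting of ψ}`. -/
def V {n : ℕ} (S : Set (Fin n → ℝ)) (ψ : (Fin n → ℝ) → ℝ) (p : Fin n → ℝ) : ℝ :=
  sInf {v | ∃ π, IsMinimalLifting S ψ π ∧ v = π p}

/-- `𝓛_{ψ,p}`: the minimal liftings `π` of `ψ` with `π(p) = V_ψ(p)`. -/
def liftingSet {n : ℕ} (S : Set (Fin n → ℝ)) (ψ : (Fin n → ℝ) → ℝ) (p : Fin n → ℝ) :
    Set ((Fin n → ℝ) → ℝ) :=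
  {π | IsMinimalLifting S ψ π ∧ π p = V S ψ p}

/-- The fixing region: the points on which all members of `𝓛_{ψ,p}` agree. -/
def fixingRegion {n : ℕ} (S : Set (Fin n → ℝ)) (ψ : (Fin n → ℝ) → ℝ) (p : Fin n → ℝ) :
    Set (Fin n → ℝ) :=
  {q | ∀ π₁ ∈ liftingSet S ψ p, ∀ π₂ ∈ liftingSet S ψ p, π₁ q = π₂ q}

/-- `W_S`: the vectors all of whose integer multiples can be added to points of `S` without
leaving `S`. -/
def translationLattice {n : ℕ} (S : Set (Fin n → ℝ)) : Set (Fin n → ℝ) :=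
  {w | ∀ s ∈ S, ∀ m : ℤ, s + (m : ℝ) • w ∈ S}

/-- The function `ψ(r) = max_i a^i · r` of the polyhedron `B = {r : a^i · r ≤ 1 for all i}`. -/
def psi {n m : ℕ} [NeZero m] (a : Fin m → Fin n → ℝ) (r : Fin n → ℝ) : ℝ :=
  Finset.univ.sup' Finset.univ_nonempty fun i => a i ⬝ᵥ r

/-- The polyhedron `B(t, p) ⊆ ℝⁿ × ℝ` built over `B = {r : a^i · r ≤ 1 for all i}`. -/
def liftedCone {n m : ℕ} (a : Fin m → Fin n → ℝ) (t : ℝ) (p : Fin n → ℝ) :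
    Set ((Fin n → ℝ) × ℝ) :=
  {q | ∀ i, a i ⬝ᵥ q.1 + (t - a i ⬝ᵥ p) * q.2 ≤ 1}

/-- The spindle `R_B(x)` of `B = {r : a^i · r ≤ 1 for all i}`. It does not depend on the choice of
an index `k` with `ψ(x) = a^k · x`. -/
def spindle {n m : ℕ} [NeZero m] (a : Fin m → Fin n → ℝ) (x : Fin n → ℝ) : Set (Fin n → ℝ) :=
  {r | ∃ k, psi a x = a k ⬝ᵥ x ∧
    ∀ i, (a i - a k) ⬝ᵥ r ≤ 0 ∧ (a i - a k) ⬝ᵥ (x - r) ≤ 0}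

/-- `S × ℤ₊ ⊆ ℝⁿ × ℝ`. -/
def prodNat {n : ℕ} (S : Set (Fin n → ℝ)) : Set ((Fin n → ℝ) × ℝ) :=
  S ×ˢ Set.range (fun N : ℕ => (N : ℝ))

/-- `C` is `D`-free: no point of `D` lies in the interior of `C`. -/
def IsFree {E : Type*} [TopologicalSpace E] (D C : Set E) : Prop :=
  D ∩ interior C = ∅

/-- `𝓧(B, p)`: the union, over the points `(x, N)` of `B(V_ψ(p), p) ∩ (S × ℤ₊)` and over
`0 ≤ i ≤ N`, of the sets `R_B(x - N p) + i p`. -/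
def fixedUnion {n m : ℕ} [NeZero m] (S : Set (Fin n → ℝ)) (a : Fin m → Fin n → ℝ)
    (p : Fin n → ℝ) : Set (Fin n → ℝ) :=
  {r | ∃ (x : Fin n → ℝ) (N : ℕ),
    (x, (N : ℝ)) ∈ liftedCone a (V S (psi a) p) p ∩ prodNat S ∧
    ∃ i ≤ N, r ∈ spindle a (x - (N : ℝ) • p) + {(i : ℝ) • p}}

/-- `P` is a translated (pointed convex) cone with apex `v`. The cone contains the origin and no
line, so `v` is determined by `P`. -/
def IsTranslatedCone {E : Type*} [AddCommGroup E] [Module ℝ E] (P : Set E) (v : E) : Prop :=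
  ∃ C : ConvexCone ℝ E, C.Pointed ∧ C.Salient ∧ ∀ x, x ∈ P ↔ x - v ∈ C

/-- The translated lattice `ℤⁿ + b`. -/
def affineLattice {n : ℕ} (b : Fin n → ℝ) : Set (Fin n → ℝ) :=
  {x | ∃ z : Fin n → ℤ, x = (fun i => (z i : ℝ)) + b}

/-- The facet normals `ω¹, ω², ω³` of the Type 3 triangle
`T(γ₁,γ₂,γ₃) = {x : ωⁱ · x ≤ 1, i = 1, 2, 3}`. -/
def omega (b : Fin 2 → ℝ) (γ₁ γ₂ γ₃ : ℝ) : Fin 3 → Fin 2 → ℝ :=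
  ![![1 / (![1, γ₁] ⬝ᵥ ![b 0 + 1, b 1 + 1]), γ₁ / (![1, γ₁] ⬝ᵥ ![b 0 + 1, b 1 + 1])],
    ![-1 / (![-1, γ₂] ⬝ᵥ ![b 0, b 1 + 1]), γ₂ / (![-1, γ₂] ⬝ᵥ ![b 0, b 1 + 1])],
    ![γ₃ / (![γ₃, -1] ⬝ᵥ ![b 0, b 1]), -1 / (![γ₃, -1] ⬝ᵥ ![b 0, b 1])]]

/-- The polyhedron `P ⊆ ℝ³`, where `ℝ³` is written `ℝ² × ℝ` and a point is
`((x₁, x₂), x₃) = ((q.1 0, q.1 1), q.2)`. -/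
def pyramid (b : Fin 2 → ℝ) (γ₁ γ₂ γ₃ : ℝ) : Set ((Fin 2 → ℝ) × ℝ) :=
  {q |
    1 / (![1, γ₁] ⬝ᵥ ![b 0 + 1, b 1 + 1]) * q.1 0
      + γ₁ / (![1, γ₁] ⬝ᵥ ![b 0 + 1, b 1 + 1]) * q.1 1
      + (1 - (![1, γ₁] ⬝ᵥ ![b 0 + 1, b 1 + 2]) / (![1, γ₁] ⬝ᵥ ![b 0 + 1, b 1 + 1])) * q.2 ≤ 1 ∧
    -(1 / (![-1, γ₂] ⬝ᵥ ![b 0, b 1 + 1])) * q.1 0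
      + γ₂ / (![-1, γ₂] ⬝ᵥ ![b 0, b 1 + 1]) * q.1 1 ≤ 1 ∧
    γ₃ / (![γ₃, -1] ⬝ᵥ ![b 0, b 1]) * q.1 0
      - 1 / (![γ₃, -1] ⬝ᵥ ![b 0, b 1]) * q.1 1
      + (1 / 2 - (![γ₃, -1] ⬝ᵥ ![1 + b 0, 2 + b 1]) / (2 * (![γ₃, -1] ⬝ᵥ ![b 0, b 1]))) * q.2
        ≤ 1}

end CutGen

end

/-! Let `p` be the horizontal part of the apex divided by its height, `t` the reciprocal of the
height, and f(r, N) = ψ(r - N p) + N t. Since the apex lies on all three facets, f(r, N) ≤ c says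
exactly that (r, N) satisfies the inequalities of P with right-hand sides multiplied by c
(`psi_omega_sub_add_le_iff`). Freeness of P thus means f ≥ 1 on S × ℤ₊, and f ≤ 1 at (b + (1, 2), 1)
forces π(p) ≥ t for every lifting π. The heart is a covering: each q has an integral w, some i, j
and x ∈ S with f(q + w, i) + f(x - q - w, j) ≤ 1. Subadditivity of ψ makes q ↦ f(q + w, i) a
lifting. The complementary term bounds every lifting with value at most `t` at `p` from below by it,
so it is the only member of the lifting set. Equality in the same estimate puts q + w in a
translated spindle. Minimizing both terms over ℤ² and i, j ∈ {0, 1} reduces the covering to the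
planar `slices_cover`. Part (i) is elimination among the facet equations; freeness implies its
condition through γ₂ ≥ 1/2. -/

namespace CutGen

/-! ### Sublinearity of ψ -/

section Psi
variable {n m : ℕ} [NeZero m] (a : Fin m → Fin n → ℝ)

theorem dotProduct_le_psi (i : Fin m) (r : Fin n → ℝ) : a i ⬝ᵥ r ≤ psi a r :=
  Finset.le_sup' (fun i => a i ⬝ᵥ r) (Finset.mem_univ i)

theorem psi_le_iff {r : Fin n → ℝ} {t : ℝ} : psi a r ≤ t ↔ ∀ i, a i ⬝ᵥ r ≤ t := by
  simp [psi]

theorem exists_psi_eq (r : Fin n → ℝ) : ∃ k, psi a r = a k ⬝ᵥ r := by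
  obtain ⟨k, -, hk⟩ := Finset.exists_mem_eq_sup' Finset.univ_nonempty fun i => a i ⬝ᵥ r
  exact ⟨k, hk⟩

theorem psi_add_le (r s : Fin n → ℝ) : psi a (r + s) ≤ psi a r + psi a s := by
  rw [psi_le_iff]
  intro i
  rw [dotProduct_add]
  exact add_le_add (dotProduct_le_psi a i r) (dotProduct_le_psi a i s)

theorem psi_smul_le {c : ℝ} (hc : 0 ≤ c) (r : Fin n → ℝ) : psi a (c • r) ≤ psi a r * c := by
  rw [psi_le_iff]
  intro i
  rw [dotProduct_smul, smul_eq_mul, mul_comm]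
  exact mul_le_mul_of_nonneg_right (dotProduct_le_psi a i r) hc

theorem psi_zero : psi a 0 = 0 := by
  obtain ⟨k, hk⟩ := exists_psi_eq a 0
  rw [hk, dotProduct_zero]

theorem psi_sum_le {ι : Type*} (s : Finset ι) (r : ι → Fin n → ℝ) :
    psi a (∑ j ∈ s, r j) ≤ ∑ j ∈ s, psi a (r j) := by
  classical
  induction s using Finset.induction_on with
  | empty => simp [psi_zero]
  | insert j s hj ih =>
    rw [Finset.sum_insert hj, Finset.sum_insert hj]
    exact (psi_add_le a _ _).trans (add_le_add le_rfl ih)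

end Psi

/-! ### Liftings and their basic inequalities -/

section Lifting
variable {n : ℕ} {S : Set (Fin n → ℝ)} {ψ π : (Fin n → ℝ) → ℝ}

/-- An affine inequality that holds on the mixed-integer set holds on its convex hull. -/
theorem isLifting_of_forall_mem
    (h : ∀ (k l : ℕ) (R : Matrix (Fin n) (Fin k) ℝ) (P : Matrix (Fin n) (Fin l) ℝ),
      ∀ q ∈ mixedIntSet S R P, 1 ≤ ∑ j, ψ (Rᵀ j) * q.1 j + ∑ j, π (Pᵀ j) * q.2 j) :
    IsLifting S ψ π := by
  intro k l _ R P q hq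
  refine convexHull_min (s := mixedIntSet S R P)
    (t := {q | 1 ≤ ∑ j, ψ (Rᵀ j) * q.1 j + ∑ j, π (Pᵀ j) * q.2 j}) (h k l R P) ?_ hq
  intro u hu v hv c e hc he hce
  simp only [Set.mem_ofPred_eq] at hu hv ⊢
  have : ∑ j, ψ (Rᵀ j) * (c • u + e • v).1 j + ∑ j, π (Pᵀ j) * (c • u + e • v).2 j
      = c * (∑ j, ψ (Rᵀ j) * u.1 j + ∑ j, π (Pᵀ j) * u.2 j)
        + e * (∑ j, ψ (Rᵀ j) * v.1 j + ∑ j, π (Pᵀ j) * v.2 j) := by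
    simp only [Prod.fst_add, Prod.snd_add, Prod.smul_fst, Prod.smul_snd, Pi.add_apply,
      Pi.smul_apply, smul_eq_mul, mul_add, Finset.sum_add_distrib, Finset.mul_sum]
    simp only [mul_left_comm]
    ring
  rw [this]
  nlinarith [mul_le_mul_of_nonneg_left hu hc, mul_le_mul_of_nonneg_left hv he]

theorem IsLifting.one_le (h : IsLifting S ψ π) {r q p : Fin n → ℝ} {i j : ℕ}
    (hS : r + (i : ℝ) • q + (j : ℝ) • p ∈ S) : 1 ≤ ψ r + i * π q + j * π p := by
  have key := h 1 2 (by norm_num) (Matrix.of fun x _ => r x) (Matrix.of fun x y => ![q x, p x] y)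
    (![1], ![(i : ℝ), (j : ℝ)]) (subset_convexHull ℝ _ ?_)
  · have e0 : (Matrix.of fun x (_ : Fin 1) => r x)ᵀ 0 = r := rfl
    have e1 : (Matrix.of fun x (y : Fin 2) => ![q x, p x] y)ᵀ 0 = q := rfl
    have e2 : (Matrix.of fun x (y : Fin 2) => ![q x, p x] y)ᵀ 1 = p := rfl
    simp only [Fin.sum_univ_two, Fin.sum_univ_one, e0, e1, e2, Matrix.cons_val_zero,
      Matrix.cons_val_one, mul_one] at key
    linarith [mul_comm (π q) i, mul_comm (π p) j]
  · refine ⟨by simp, ?_, ?_⟩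
    · intro y
      fin_cases y
      · exact ⟨i, rfl⟩
      · exact ⟨j, rfl⟩
    · convert hS using 1
      ext x
      simp
      ring

end Lifting

/-! ### Uniqueness of the lifting from a tight covering -/

section FixedPoint
variable {n m : ℕ} [NeZero m] {a : Fin m → Fin n → ℝ} {S : Set (Fin n → ℝ)}
  {L : AddSubgroup (Fin n → ℝ)} {p : Fin n → ℝ} {t : ℝ}

/-- If `π q` is the value of a representation of `q` by the point `p` modulo translations, for
every `q`, then `π` is a lifting. -/
theorem isLifting_of_representation (hL : ∀ s ∈ S, ∀ w ∈ L, s + w ∈ S)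
    (hfree : ∀ x ∈ S, ∀ N : ℕ, 1 ≤ psi a (x - (N : ℝ) • p) + N * t)
    {π : (Fin n → ℝ) → ℝ}
    (hπ : ∀ q, ∃ w ∈ L, ∃ i : ℕ, psi a (q + w - (i : ℝ) • p) + i * t = π q) :
    IsLifting S (psi a) π := by
  choose w hw i hi using hπ
  refine isLifting_of_forall_mem ?_
  rintro k l R P ⟨s, y⟩ ⟨hs, hy, hS⟩
  choose y' hy' using hy
  simp only at hs hy' hS ⊢
  -- Replacing each integer column by its representation uses `N` copies of `p` in total and moves
  -- the sum to another point `x` of `S`.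
  set N : ℕ := ∑ j, i (Pᵀ j) * y' j with hN
  set x : Fin n → ℝ := R *ᵥ s + P *ᵥ y + ∑ j, y' j • w (Pᵀ j) with hx
  have hxS : x ∈ S := hL _ hS _ (sum_mem fun j _ => L.nsmul_mem (hw _) _)
  have hdecomp : x - (N : ℝ) • p = ∑ j, s j • Rᵀ j
      + ∑ j, y j • (Pᵀ j + w (Pᵀ j) - (i (Pᵀ j) : ℝ) • p) := by
    rw [hx, hN]
    simp only [smul_sub, smul_add, Finset.sum_sub_distrib, Finset.sum_add_distrib, hy']
    ext z
    simp [Matrix.mulVec, dotProduct, hy', Finset.mul_sum, mul_comm, mul_left_comm]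
    ring
  have hval : ∑ j, π (Pᵀ j) * y j
      = ∑ j, psi a (Pᵀ j + w (Pᵀ j) - (i (Pᵀ j) : ℝ) • p) * y j + N * t := by
    rw [hN]
    push_cast
    rw [Finset.sum_mul, ← Finset.sum_add_distrib]
    refine Finset.sum_congr rfl fun j _ => ?_
    rw [← hi, hy']
    ring
  have h1 := hfree x hxS N
  rw [hdecomp] at h1
  have h2 := psi_add_le a (∑ j, s j • Rᵀ j)
    (∑ j, y j • (Pᵀ j + w (Pᵀ j) - (i (Pᵀ j) : ℝ) • p))
  have h3 := (psi_sum_le a Finset.univ fun j => s j • Rᵀ j).trans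
    (Finset.sum_le_sum fun j _ => psi_smul_le a (hs j) (Rᵀ j))
  have h4 := (psi_sum_le a Finset.univ
      fun j => y j • (Pᵀ j + w (Pᵀ j) - (i (Pᵀ j) : ℝ) • p)).trans
    (Finset.sum_le_sum fun j _ => psi_smul_le a (by rw [hy']; positivity)
      (Pᵀ j + w (Pᵀ j) - (i (Pᵀ j) : ℝ) • p))
  rw [hval]
  linarith

/-- The least lifting among those of value at most `t` at `p`, when every point is represented
tightly. -/
theorem exists_least_lifting (hL : ∀ s ∈ S, ∀ w ∈ L, s + w ∈ S)
    (hfree : ∀ x ∈ S, ∀ N : ℕ, 1 ≤ psi a (x - (N : ℝ) • p) + N * t)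
    (hcover : ∀ q, ∃ w ∈ L, ∃ i j : ℕ, ∃ x ∈ S,
      psi a (q + w - (i : ℝ) • p) + i * t + (psi a (x - (q + w) - (j : ℝ) • p) + j * t) ≤ 1) :
    ∃ π, IsLifting S (psi a) π ∧ π p ≤ t ∧
      ∀ π', IsLifting S (psi a) π' → π' p ≤ t → π ≤ π' := by
  choose w hw i j x hx h using hcover
  set π : (Fin n → ℝ) → ℝ := fun q => psi a (q + w q - (i q : ℝ) • p) + i q * t with hπ
  have hlift : IsLifting S (psi a) π :=
    isLifting_of_representation hL hfree fun q => ⟨w q, hw q, i q, rfl⟩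
  have hle : ∀ π', IsLifting S (psi a) π' → π' p ≤ t → π ≤ π' := by
    intro π' hπ' hp q
    -- The complementary part is paid for by `ψ` and `j q` copies of `p`, so validity bounds `π' q`
    -- from below.
    have h1 := hπ'.one_le (r := x q - (q + w q) - (j q : ℝ) • p) (q := q) (p := p) (i := 1)
      (j := j q) (by
        have := hL _ (hx q) _ (L.neg_mem (hw q))
        convert this using 1
        simp only [Nat.cast_one, one_smul]
        abel)
    have h2 := mul_le_mul_of_nonneg_left hp (Nat.cast_nonneg (α := ℝ) (j q))
    have h3 := h q
    simp only [hπ]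
    push_cast at h1
    linarith
  refine ⟨π, hlift, ?_, hle⟩
  -- Counting `p` itself as one more copy, freeness bounds the complementary term at `p` below by `1
  -- - t`.
  have h1 := hfree (x p - w p) (by
    rw [sub_eq_add_neg]
    exact hL _ (hx p) _ (L.neg_mem (hw p))) (j p + 1)
  have h2 : x p - w p - ((j p + 1 : ℕ) : ℝ) • p = x p - (p + w p) - (j p : ℝ) • p := by
    push_cast
    rw [add_smul, one_smul]
    abel
  rw [h2] at h1
  push_cast at h1
  have h3 := h p
  simp only [hπ]
  linarith

variable (hL : ∀ s ∈ S, ∀ w ∈ L, s + w ∈ S)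
    (hfree : ∀ x ∈ S, ∀ N : ℕ, 1 ≤ psi a (x - (N : ℝ) • p) + N * t)
    (htight : ∃ x ∈ S, ∃ N : ℕ, 0 < N ∧ psi a (x - (N : ℝ) • p) + N * t ≤ 1)
    (hcover : ∀ q, ∃ w ∈ L, ∃ i j : ℕ, ∃ x ∈ S,
      psi a (q + w - (i : ℝ) • p) + i * t + (psi a (x - (q + w) - (j : ℝ) • p) + j * t) ≤ 1)

include htight in
theorem IsLifting.le_apply_of_tight {π : (Fin n → ℝ) → ℝ} (hπ : IsLifting S (psi a) π) :
    t ≤ π p := by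
  obtain ⟨x, hx, N, hN, h⟩ := htight
  have h1 := hπ.one_le (r := x - (N : ℝ) • p) (q := 0) (p := p) (i := 0) (j := N) (by simpa)
  have hN' : (0 : ℝ) < N := by exact_mod_cast hN
  simp only [Nat.cast_zero, zero_mul, add_zero] at h1
  exact le_of_mul_le_mul_left (by linarith) hN'

include hL hfree htight hcover in
theorem V_eq_and_existsUnique :
    V S (psi a) p = t ∧ ∃! π, π ∈ liftingSet S (psi a) p := by
  obtain ⟨π, hπ, hπp, hle⟩ := exists_least_lifting hL hfree hcover
  have hp : π p = t := le_antisymm hπp (hπ.le_apply_of_tight htight)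
  have hmin : IsMinimalLifting S (psi a) π :=
    ⟨hπ, fun π' hπ' h => hle π' hπ' ((h p).trans hπp)⟩
  have hV : V S (psi a) p = t := by
    refine IsLeast.csInf_eq ⟨⟨π, hmin, hp.symm⟩, ?_⟩
    rintro v ⟨π', hπ', rfl⟩
    exact hπ'.1.le_apply_of_tight htight
  refine ⟨hV, π, ⟨hmin, hp.trans hV.symm⟩, ?_⟩
  rintro π' ⟨hπ', hp'⟩
  have h := hle π' hπ'.1 (hp'.trans hV).le
  exact le_antisymm (hπ'.2 hπ h) h

include hL hfree htight hcover in
theorem fixedUnion_add_translationLattice :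
    fixedUnion S a p + translationLattice S = Set.univ := by
  rw [Set.eq_univ_iff_forall]
  intro q
  obtain ⟨w, hw, i, j, x, hx, h⟩ := hcover q
  have hV := (V_eq_and_existsUnique hL hfree htight hcover).1
  refine ⟨q + w, ?_, -w, ?_, by simp⟩
  · set u := q + w - (i : ℝ) • p with hu
    set v := x - (q + w) - (j : ℝ) • p with hv
    have huv : x - ((i + j : ℕ) : ℝ) • p = u + v := by
      rw [hu, hv]
      push_cast
      rw [add_smul]
      abel
    -- Freeness and the covering bound squeeze `ψ` to be additive on `u + v`, so an index attaining
    -- `ψ (u + v)` also attains `ψ u` and `ψ v`.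
    have hf := hfree x hx (i + j)
    rw [huv] at hf
    push_cast at hf
    have hsub := psi_add_le a u v
    refine ⟨x, i + j, ⟨?_, hx, i + j, rfl⟩, i, Nat.le_add_right _ _, u, ?_, (i : ℝ) • p, rfl,
      by simp [hu]⟩
    · intro k
      have h1 := dotProduct_le_psi a k (x - ((i + j : ℕ) : ℝ) • p)
      rw [hV]
      rw [huv] at h1
      have h2 : a k ⬝ᵥ x = a k ⬝ᵥ (u + v) + ((i : ℝ) + j) * a k ⬝ᵥ p := by
        rw [← huv, dotProduct_sub, dotProduct_smul, smul_eq_mul]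
        push_cast
        ring
      rw [h2]
      push_cast
      linarith
    · obtain ⟨k, hk⟩ := exists_psi_eq a (u + v)
      refine ⟨k, by rw [huv]; exact hk, fun l => ?_⟩
      rw [huv, add_sub_cancel_left, sub_dotProduct, sub_dotProduct]
      rw [dotProduct_add] at hk
      have := dotProduct_le_psi a k u
      have := dotProduct_le_psi a k v
      have := dotProduct_le_psi a l u
      have := dotProduct_le_psi a l v
      constructor <;> linarith
  · intro s hs c
    have := hL s hs _ (L.zsmul_mem (L.neg_mem hw) c)
    rwa [← Int.cast_smul_eq_zsmul ℝ] at this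

end FixedPoint

theorem fixingRegion_eq_univ_of_existsUnique {n : ℕ} {S : Set (Fin n → ℝ)}
    {ψ : (Fin n → ℝ) → ℝ} {p : Fin n → ℝ} (h : ∃! π, π ∈ liftingSet S ψ p) :
    fixingRegion S ψ p = Set.univ := by
  rw [Set.eq_univ_iff_forall]
  intro q π₁ h₁ π₂ h₂
  rw [h.unique h₁ h₂]

/-- For every `t`, the plane is covered modulo `ℤ²` by the bottom two slices of two pyramids. -/
theorem slices_cover {γ₁ γ₂ γ₃ : ℝ} (hγ₂ : 0 < γ₂) (hγ₃ : 0 < γ₃)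
    (hγ₂' : γ₂ < 1) (hγ₃' : γ₃ < 1) (t x₀ y₀ : ℝ) :
    (∃ m n : ℤ, ∃ i : Fin 2, x₀ + m + γ₁ * (y₀ + n) ≤ t * (1 + γ₁) ∧
      γ₂ * (y₀ + n + (i : ℕ) - t) ≤ x₀ + m ∧ γ₃ * (x₀ + m - (i : ℕ) / 2) ≤ y₀ + n) ∨
    (∃ m n : ℤ, ∃ j : Fin 2, -((1 - t) * (1 + γ₁)) ≤ x₀ + m + γ₁ * (y₀ + n) ∧
      x₀ + m ≤ γ₂ * (y₀ + n - (j : ℕ) + (1 - t)) ∧ y₀ + n ≤ γ₃ * (x₀ + m + (j : ℕ) / 2)) := by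
  by_contra! hcon
  obtain ⟨hA, hB⟩ := hcon
  -- `c m` is the lowest lattice point of column `m` on or above the line y = γ₃ x; `m` below is the
  -- first column where that point also satisfies the second inequality.
  let c : ℤ → ℤ := fun m => ⌈γ₃ * (x₀ + m) - y₀⌉
  have hc₁ (m : ℤ) : γ₃ * (x₀ + m) ≤ y₀ + c m := by
    linarith [Int.le_ceil (γ₃ * (x₀ + m) - y₀)]
  have hc₂ (m : ℤ) : y₀ + c m < γ₃ * (x₀ + m) + 1 := by
    linarith [Int.ceil_lt_add_one (γ₃ * (x₀ + m) - y₀)]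
  have hγ : 0 < 1 - γ₂ * γ₃ := by nlinarith
  obtain ⟨m, hm, hmin⟩ := Int.exists_least_of_bdd
    (P := fun m : ℤ => γ₂ * (y₀ + c m - t) ≤ x₀ + m)
    ⟨⌈(-(γ₂ * t)) / (1 - γ₂ * γ₃) - x₀⌉, fun z hz => by
      have h1 := mul_le_mul_of_nonneg_left (hc₁ z) hγ₂.le
      have h2 : (-(γ₂ * t)) / (1 - γ₂ * γ₃) ≤ x₀ + z := by
        rw [div_le_iff₀ hγ]
        linarith
      exact Int.ceil_le.2 (by linarith)⟩
    ⟨⌈(γ₂ * (1 - t)) / (1 - γ₂ * γ₃) - x₀⌉, by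
      set z := ⌈(γ₂ * (1 - t)) / (1 - γ₂ * γ₃) - x₀⌉
      have h1 := mul_le_mul_of_nonneg_left (hc₂ z).le hγ₂.le
      have h2 : (γ₂ * (1 - t)) / (1 - γ₂ * γ₃) ≤ x₀ + z := by
        linarith [Int.le_ceil ((γ₂ * (1 - t)) / (1 - γ₂ * γ₃) - x₀)]
      rw [div_le_iff₀ hγ] at h2
      linarith⟩
  have hprev : x₀ + m - 1 < γ₂ * (y₀ + c (m - 1) - t) := by
    by_contra! h
    have := hmin (m - 1) (by push_cast; linarith)
    omega
  have h₁ := hc₁ m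
  have h₂ := hc₂ m
  have h₁' := hc₁ (m - 1)
  have h₂' := hc₂ (m - 1)
  have hA₀ := hA m (c m) 0
  have hB₀ := hB (m - 1) (c m - 1) 0
  have hB₁ := hB (m - 1) (c m - 1) 1
  have hA₁ := hA m (c m - 1) 1
  have hB₂ := hB (m - 1) (c m - 2) 0
  push_cast at *
  simp only [Fin.val_zero, Fin.val_one, Nat.cast_zero, Nat.cast_one] at *
  have ha : t * (1 + γ₁) < x₀ + m + γ₁ * (y₀ + c m) := by
    by_contra! h
    linarith [hA₀ h (by linarith)]
  -- As γ₃ < 1, the staircase rises by 0 or 1. If it did not rise, `(m - 1, c m - 1)` would lie in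
  -- the reflected slice 0.
  have hstep : c (m - 1) = c m - 1 := by
    have hle : c m ≤ c (m - 1) + 1 := by
      have : (c m : ℝ) < c (m - 1) + 2 := by linarith
      have : c m < c (m - 1) + 2 := by exact_mod_cast this
      omega
    have hge : c (m - 1) ≤ c m := by
      have : (c (m - 1) : ℝ) < c m + 1 := by linarith
      have : c (m - 1) < c m + 1 := by exact_mod_cast this
      omega
    have hne : c (m - 1) ≠ c m := by
      intro h
      rw [h] at hprev h₂'
      have := hB₀ (by linarith) (by linarith)
      linarith
    omega
  rw [hstep] at hprev h₁' h₂'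
  push_cast at hprev h₁' h₂'
  -- The half shifts of the two slices at height 1 match: missing the reflected one at column `m -
  -- 1` gives the third inequality of the direct one at column `m`.
  have hb := hB₁ (by linarith) (by linarith)
  have ha' : t * (1 + γ₁) < x₀ + m + γ₁ * (y₀ + (c m - 1)) := by
    by_contra! h
    linarith [hA₁ h (by linarith)]
  linarith [hB₂ (by linarith) (by linarith)]

/-! ### The pyramid: facets, apex and freeness -/

section Triangle
variable {b : Fin 2 → ℝ} {γ₁ γ₂ γ₃ : ℝ}

/-- On the triangle -1 ≤ b₂ ≤ b₁ ≤ 0 each form is nonnegative and can vanish only at an integral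
vertex. -/
theorem denominators_pos (hb : ¬ ∃ z : Fin 2 → ℤ, b = fun i => (z i : ℝ))
    (hb₁ : -1 ≤ b 1) (hb₂ : b 1 ≤ b 0) (hb₃ : b 0 ≤ 0)
    (hγ₁ : 0 < γ₁) (hγ₂ : 0 < γ₂) (hγ₃' : γ₃ < 1) :
    0 < 1 + γ₁ + b 0 + γ₁ * b 1 ∧ 0 < γ₂ - b 0 + γ₂ * b 1 ∧ 0 < γ₃ * b 0 - b 1 := by
  have hne (u v : ℤ) : ¬(b 0 = u ∧ b 1 = v) := fun h =>
    hb ⟨![u, v], by ext i; fin_cases i <;> simp [h.1, h.2]⟩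
  have h₁ := hne (-1) (-1)
  have h₂ := hne 0 (-1)
  have h₃ := hne 0 0
  push_cast at h₁ h₂ h₃
  refine ⟨?_, ?_, ?_⟩
  · by_contra! h
    have := mul_nonneg hγ₁.le (by linarith : 0 ≤ b 1 + 1)
    have h0 : b 0 = -1 := by linarith
    exact h₁ ⟨h0, by linarith⟩
  · by_contra! h
    have := mul_nonneg hγ₂.le (by linarith : 0 ≤ b 1 + 1)
    have h0 : b 0 = 0 := by linarith
    have h1 : γ₂ * (b 1 + 1) = 0 := by linarith
    exact h₂ ⟨h0, by linarith [(mul_eq_zero.1 h1).resolve_left hγ₂.ne']⟩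
  · by_contra! h
    have := mul_nonneg (by linarith : 0 ≤ 1 - γ₃) (by linarith : 0 ≤ -b 0)
    have h1 : b 0 = b 1 := by linarith
    have h0 : (1 - γ₃) * b 0 = 0 := by linarith
    have := (mul_eq_zero.1 h0).resolve_left (by linarith)
    exact h₃ ⟨this, by linarith⟩

variable (hd₁ : 0 < 1 + γ₁ + b 0 + γ₁ * b 1) (hd₂ : 0 < γ₂ - b 0 + γ₂ * b 1)
  (hd₃ : 0 < γ₃ * b 0 - b 1)

include hd₁ hd₂ hd₃

theorem mem_pyramid_iff (q : (Fin 2 → ℝ) × ℝ) : q ∈ pyramid b γ₁ γ₂ γ₃ ↔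
    q.1 0 + γ₁ * q.1 1 - γ₁ * q.2 ≤ 1 + γ₁ + b 0 + γ₁ * b 1 ∧
    -q.1 0 + γ₂ * q.1 1 ≤ γ₂ - b 0 + γ₂ * b 1 ∧
    γ₃ * q.1 0 - q.1 1 + (1 - γ₃ / 2) * q.2 ≤ γ₃ * b 0 - b 1 := by
  have e₁ : ![1, γ₁] ⬝ᵥ ![b 0 + 1, b 1 + 1] = 1 + γ₁ + b 0 + γ₁ * b 1 := by
    simp; ring
  have e₂ : ![-1, γ₂] ⬝ᵥ ![b 0, b 1 + 1] = γ₂ - b 0 + γ₂ * b 1 := by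
    simp; ring
  have e₃ : ![γ₃, -1] ⬝ᵥ ![b 0, b 1] = γ₃ * b 0 - b 1 := by
    simp; ring
  have e₄ : ![1, γ₁] ⬝ᵥ ![b 0 + 1, b 1 + 2] = 1 + γ₁ + b 0 + γ₁ * b 1 + γ₁ := by
    simp; ring
  have e₅ : ![γ₃, -1] ⬝ᵥ ![1 + b 0, 2 + b 1] = γ₃ * b 0 - b 1 - (2 - γ₃) := by
    simp; ring
  simp only [pyramid, Set.mem_ofPred_eq, e₁, e₂, e₃, e₄, e₅]
  generalize 1 + γ₁ + b 0 + γ₁ * b 1 = d₁ at *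
  generalize γ₂ - b 0 + γ₂ * b 1 = d₂ at *
  generalize γ₃ * b 0 - b 1 = d₃ at *
  refine and_congr ?_ (and_congr ?_ ?_)
  · rw [← div_le_one hd₁]
    refine iff_of_eq (congrArg (· ≤ 1) ?_)
    field_simp
    ring
  · rw [← div_le_one hd₂]
    refine iff_of_eq (congrArg (· ≤ 1) ?_)
    field_simp
  · rw [← div_le_one hd₃]
    refine iff_of_eq (congrArg (· ≤ 1) ?_)
    field_simp
    ring

theorem psi_omega_le_iff (r : Fin 2 → ℝ) (t : ℝ) : psi (omega b γ₁ γ₂ γ₃) r ≤ t ↔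
    r 0 + γ₁ * r 1 ≤ t * (1 + γ₁ + b 0 + γ₁ * b 1) ∧
    -r 0 + γ₂ * r 1 ≤ t * (γ₂ - b 0 + γ₂ * b 1) ∧
    γ₃ * r 0 - r 1 ≤ t * (γ₃ * b 0 - b 1) := by
  have e₁ : ![1, γ₁] ⬝ᵥ ![b 0 + 1, b 1 + 1] = 1 + γ₁ + b 0 + γ₁ * b 1 := by
    simp; ring
  have e₂ : ![-1, γ₂] ⬝ᵥ ![b 0, b 1 + 1] = γ₂ - b 0 + γ₂ * b 1 := by
    simp; ring
  have e₃ : ![γ₃, -1] ⬝ᵥ ![b 0, b 1] = γ₃ * b 0 - b 1 := by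
    simp; ring
  rw [psi_le_iff, Fin.forall_fin_succ, Fin.forall_fin_two]
  simp only [omega, e₁, e₂, e₃]
  generalize 1 + γ₁ + b 0 + γ₁ * b 1 = d₁ at *
  generalize γ₂ - b 0 + γ₂ * b 1 = d₂ at *
  generalize γ₃ * b 0 - b 1 = d₃ at *
  refine and_congr ?_ (and_congr ?_ ?_)
  · rw [← div_le_iff₀ hd₁]
    refine iff_of_eq (congrArg (· ≤ t) ?_)
    simp [dotProduct, Fin.sum_univ_two]
    field_simp
  · rw [← div_le_iff₀ hd₂]
    refine iff_of_eq (congrArg (· ≤ t) ?_)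
    simp [dotProduct, Fin.sum_univ_two]
    field_simp
  · rw [← div_le_iff₀ hd₃]
    refine iff_of_eq (congrArg (· ≤ t) ?_)
    simp [dotProduct, Fin.sum_univ_two]
    field_simp
    ring

/-- The apex of a translated cone `pyramid b γ₁ γ₂ γ₃` lies on the three facet planes. -/
theorem facets_eq_of_isTranslatedCone {v a : (Fin 2 → ℝ) × ℝ}
    (hv : IsTranslatedCone (pyramid b γ₁ γ₂ γ₃) v)
    (ha : a.1 0 + γ₁ * a.1 1 - γ₁ * a.2 = 1 + γ₁ + b 0 + γ₁ * b 1 ∧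
      -a.1 0 + γ₂ * a.1 1 = γ₂ - b 0 + γ₂ * b 1 ∧
      γ₃ * a.1 0 - a.1 1 + (1 - γ₃ / 2) * a.2 = γ₃ * b 0 - b 1) :
    v.1 0 + γ₁ * v.1 1 - γ₁ * v.2 = 1 + γ₁ + b 0 + γ₁ * b 1 ∧
      -v.1 0 + γ₂ * v.1 1 = γ₂ - b 0 + γ₂ * b 1 ∧
      γ₃ * v.1 0 - v.1 1 + (1 - γ₃ / 2) * v.2 = γ₃ * b 0 - b 1 := by
  obtain ⟨C, hC0, -, hC⟩ := hv
  obtain ⟨ha₁, ha₂, ha₃⟩ := ha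
  have hv0 : v ∈ pyramid b γ₁ γ₂ γ₃ := (hC v).2 (by rw [sub_self]; exact hC0)
  have ha0 : a ∈ pyramid b γ₁ γ₂ γ₃ :=
    (mem_pyramid_iff hd₁ hd₂ hd₃ a).2 ⟨ha₁.le, ha₂.le, ha₃.le⟩
  -- The reflection of `v` through `a` stays in the cone, which reverses the inequalities at `v`.
  have hva : v + (2 : ℝ) • (a - v) ∈ pyramid b γ₁ γ₂ γ₃ := by
    rw [hC, add_sub_cancel_left]
    exact C.smul_mem two_pos ((hC a).1 ha0)
  rw [mem_pyramid_iff hd₁ hd₂ hd₃] at hv0 hva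
  simp at hva
  obtain ⟨h₁, h₂, h₃⟩ := hv0
  obtain ⟨h₁', h₂', h₃'⟩ := hva
  refine ⟨le_antisymm h₁ ?_, le_antisymm h₂ ?_, le_antisymm h₃ ?_⟩ <;> linarith

-- The multipliers 1 - γ₂γ₃, 1 + γ₁γ₃, γ₁ + γ₂ are the positive dependency of the planar normals;
-- the sign of the height is therefore that of its coefficient.
omit hd₁ hd₂ hd₃ in
theorem apex_height_mul {v : (Fin 2 → ℝ) × ℝ}
    (hv : v.1 0 + γ₁ * v.1 1 - γ₁ * v.2 = 1 + γ₁ + b 0 + γ₁ * b 1 ∧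
      -v.1 0 + γ₂ * v.1 1 = γ₂ - b 0 + γ₂ * b 1 ∧
      γ₃ * v.1 0 - v.1 1 + (1 - γ₃ / 2) * v.2 = γ₃ * b 0 - b 1) :
    v.2 * (γ₂ * (2 - γ₃ + 2 * γ₁ * γ₃) - γ₁ * γ₃) =
      2 * ((1 - γ₂ * γ₃) * (1 + γ₁ + b 0 + γ₁ * b 1) + (1 + γ₁ * γ₃) * (γ₂ - b 0 + γ₂ * b 1)
        + (γ₁ + γ₂) * (γ₃ * b 0 - b 1)) := by
  obtain ⟨h₁, h₂, h₃⟩ := hv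
  linear_combination 2 * (1 - γ₂ * γ₃) * h₁ + 2 * (1 + γ₁ * γ₃) * h₂ + 2 * (γ₁ + γ₂) * h₃

omit hd₁ hd₂ hd₃ in
theorem exists_apex (hD : γ₂ * (2 - γ₃ + 2 * γ₁ * γ₃) - γ₁ * γ₃ ≠ 0) (hγ : γ₁ + γ₂ ≠ 0) :
    ∃ v : (Fin 2 → ℝ) × ℝ, v.1 0 + γ₁ * v.1 1 - γ₁ * v.2 = 1 + γ₁ + b 0 + γ₁ * b 1 ∧
      -v.1 0 + γ₂ * v.1 1 = γ₂ - b 0 + γ₂ * b 1 ∧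
      γ₃ * v.1 0 - v.1 1 + (1 - γ₃ / 2) * v.2 = γ₃ * b 0 - b 1 := by
  generalize 1 + γ₁ + b 0 + γ₁ * b 1 = d₁
  generalize γ₂ - b 0 + γ₂ * b 1 = d₂
  generalize γ₃ * b 0 - b 1 = d₃
  set D := γ₂ * (2 - γ₃ + 2 * γ₁ * γ₃) - γ₁ * γ₃ with hDdef
  set z := 2 * ((1 - γ₂ * γ₃) * d₁ + (1 + γ₁ * γ₃) * d₂ + (γ₁ + γ₂) * d₃) / D with hz
  have hzD : z * D = 2 * ((1 - γ₂ * γ₃) * d₁ + (1 + γ₁ * γ₃) * d₂ + (γ₁ + γ₂) * d₃) := by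
    rw [hz, div_mul_cancel₀ _ hD]
  set y := (d₁ + d₂ + γ₁ * z) / (γ₁ + γ₂) with hy
  have hyD : y * (γ₁ + γ₂) = d₁ + d₂ + γ₁ * z := by
    rw [hy, div_mul_cancel₀ _ hγ]
  refine ⟨(![γ₂ * y - d₂, y], z), ?_, ?_, ?_⟩ <;> simp
  · linear_combination hyD
  · refine mul_right_cancel₀ hγ ?_
    linear_combination (γ₂ * γ₃ - 1) * hyD + hzD / 2

theorem isTranslatedCone_pyramid (hD : γ₂ * (2 - γ₃ + 2 * γ₁ * γ₃) - γ₁ * γ₃ ≠ 0)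
    (hγ : γ₁ + γ₂ ≠ 0) {v : (Fin 2 → ℝ) × ℝ}
    (hv : v.1 0 + γ₁ * v.1 1 - γ₁ * v.2 = 1 + γ₁ + b 0 + γ₁ * b 1 ∧
      -v.1 0 + γ₂ * v.1 1 = γ₂ - b 0 + γ₂ * b 1 ∧
      γ₃ * v.1 0 - v.1 1 + (1 - γ₃ / 2) * v.2 = γ₃ * b 0 - b 1) :
    IsTranslatedCone (pyramid b γ₁ γ₂ γ₃) v := by
  obtain ⟨hv₁, hv₂, hv₃⟩ := hv
  refine ⟨⟨{x | x.1 0 + γ₁ * x.1 1 - γ₁ * x.2 ≤ 0 ∧ -x.1 0 + γ₂ * x.1 1 ≤ 0 ∧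
    γ₃ * x.1 0 - x.1 1 + (1 - γ₃ / 2) * x.2 ≤ 0}, ?_, ?_⟩, ?_, ?_, ?_⟩
  · rintro c hc x ⟨h₁, h₂, h₃⟩
    have h₁ := mul_nonpos_of_nonneg_of_nonpos hc.le h₁
    have h₂ := mul_nonpos_of_nonneg_of_nonpos hc.le h₂
    have h₃ := mul_nonpos_of_nonneg_of_nonpos hc.le h₃
    refine ⟨?_, ?_, ?_⟩ <;> simp <;> linarith
  · rintro x ⟨h₁, h₂, h₃⟩ y ⟨h₁', h₂', h₃'⟩
    refine ⟨?_, ?_, ?_⟩ <;> simp <;> linarith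
  · exact ⟨by simp, by simp, by simp⟩
  · rintro x ⟨h₁, h₂, h₃⟩ hx ⟨h₁', h₂', h₃'⟩
    simp at h₁' h₂' h₃'
    have e₁ : x.1 0 + γ₁ * x.1 1 - γ₁ * x.2 = 0 := by linarith
    have e₂ : -x.1 0 + γ₂ * x.1 1 = 0 := by linarith
    have e₃ : γ₃ * x.1 0 - x.1 1 + (1 - γ₃ / 2) * x.2 = 0 := by linarith
    have hz : x.2 = 0 := by
      refine (mul_eq_zero.1 ?_).resolve_right hD
      linear_combination 2 * (1 - γ₂ * γ₃) * e₁ + 2 * (1 + γ₁ * γ₃) * e₂ + 2 * (γ₁ + γ₂) * e₃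
    have hy : x.1 1 = 0 := by
      refine (mul_eq_zero.1 ?_).resolve_right hγ
      linear_combination e₁ + e₂ + γ₁ * hz
    refine hx (Prod.ext (funext fun i => ?_) hz)
    fin_cases i
    · simp
      linear_combination -e₂ + γ₂ * hy
    · exact hy
  · intro x
    rw [mem_pyramid_iff hd₁ hd₂ hd₃]
    change _ ↔ _ ∧ _ ∧ _
    simp
    refine and_congr ?_ (and_congr ?_ ?_) <;> constructor <;> intro h <;> linarith

/-- If the facet normals are linearly dependent, the pyramid contains a line. -/
theorem not_isTranslatedCone_of_eq_zero (hD : γ₂ * (2 - γ₃ + 2 * γ₁ * γ₃) - γ₁ * γ₃ = 0)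
    (hγ : γ₁ + γ₂ ≠ 0) (v : (Fin 2 → ℝ) × ℝ) :
    ¬ IsTranslatedCone (pyramid b γ₁ γ₂ γ₃) v := by
  rintro ⟨C, hC0, hCs, hC⟩
  have hv0 : v ∈ pyramid b γ₁ γ₂ γ₃ := (hC v).2 (by rw [sub_self]; exact hC0)
  rw [mem_pyramid_iff hd₁ hd₂ hd₃] at hv0
  obtain ⟨h₁, h₂, h₃⟩ := hv0
  -- This direction is parallel to the first two facets, and the third form takes on it `c / 2`
  -- times the vanishing determinant.
  have key (c : ℝ) : ((![c * (γ₁ * γ₂), c * γ₁], c * (γ₁ + γ₂)) : (Fin 2 → ℝ) × ℝ) ∈ C := by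
    have : v + (![c * (γ₁ * γ₂), c * γ₁], c * (γ₁ + γ₂)) ∈ pyramid b γ₁ γ₂ γ₃ := by
      rw [mem_pyramid_iff hd₁ hd₂ hd₃]
      have : c / 2 * (γ₂ * (2 - γ₃ + 2 * γ₁ * γ₃) - γ₁ * γ₃) = 0 := by rw [hD, mul_zero]
      simp
      refine ⟨?_, ?_, ?_⟩ <;> linarith
    rw [hC, add_sub_cancel_left] at this
    exact this
  refine hCs _ (key 1) (fun h => hγ (by simpa using congrArg Prod.snd h)) ?_
  convert key (-1) using 1
  ext i
  · fin_cases i <;> simp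
  · simp

theorem exists_isTranslatedCone_iff (hγ₁ : 0 < γ₁) (hγ₂ : 0 < γ₂) (hγ₃ : 0 < γ₃)
    (hγ₂' : γ₂ < 1) (hγ₃' : γ₃ < 1) :
    (∃ v, IsTranslatedCone (pyramid b γ₁ γ₂ γ₃) v ∧ 0 < v.2) ↔
      0 < γ₂ * (2 - γ₃ + 2 * γ₁ * γ₃) - γ₁ * γ₃ := by
  have hγ : 0 < 1 - γ₂ * γ₃ := by nlinarith
  have hsum : γ₁ + γ₂ ≠ 0 := by positivity
  have hpos : 0 < 2 * ((1 - γ₂ * γ₃) * (1 + γ₁ + b 0 + γ₁ * b 1)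
      + (1 + γ₁ * γ₃) * (γ₂ - b 0 + γ₂ * b 1) + (γ₁ + γ₂) * (γ₃ * b 0 - b 1)) := by positivity
  constructor
  · rintro ⟨v, hv, hv0⟩
    have hD : γ₂ * (2 - γ₃ + 2 * γ₁ * γ₃) - γ₁ * γ₃ ≠ 0 :=
      fun h => not_isTranslatedCone_of_eq_zero hd₁ hd₂ hd₃ h hsum v hv
    obtain ⟨a, ha⟩ := exists_apex (b := b) hD hsum
    have := apex_height_mul (facets_eq_of_isTranslatedCone hd₁ hd₂ hd₃ hv ha)
    exact pos_of_mul_pos_right (this ▸ hpos) hv0.le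
  · intro hD
    obtain ⟨v, hv⟩ := exists_apex (b := b) hD.ne' hsum
    exact ⟨v, isTranslatedCone_pyramid hd₁ hd₂ hd₃ hD.ne' hsum hv,
      pos_of_mul_pos_left (apex_height_mul hv ▸ hpos) hD.le⟩

theorem mem_interior_pyramid {q : (Fin 2 → ℝ) × ℝ}
    (h₁ : q.1 0 + γ₁ * q.1 1 - γ₁ * q.2 < 1 + γ₁ + b 0 + γ₁ * b 1)
    (h₂ : -q.1 0 + γ₂ * q.1 1 < γ₂ - b 0 + γ₂ * b 1)
    (h₃ : γ₃ * q.1 0 - q.1 1 + (1 - γ₃ / 2) * q.2 < γ₃ * b 0 - b 1) :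
    q ∈ interior (pyramid b γ₁ γ₂ γ₃) := by
  rw [mem_interior]
  refine ⟨{q | q.1 0 + γ₁ * q.1 1 - γ₁ * q.2 < 1 + γ₁ + b 0 + γ₁ * b 1} ∩
    ({q | -q.1 0 + γ₂ * q.1 1 < γ₂ - b 0 + γ₂ * b 1} ∩
    {q | γ₃ * q.1 0 - q.1 1 + (1 - γ₃ / 2) * q.2 < γ₃ * b 0 - b 1}), ?_, ?_, h₁, h₂, h₃⟩
  · rintro x ⟨hx₁, hx₂, hx₃⟩
    exact (mem_pyramid_iff hd₁ hd₂ hd₃ x).2 ⟨le_of_lt hx₁, le_of_lt hx₂, le_of_lt hx₃⟩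
  · refine (isOpen_lt ?_ ?_).inter ((isOpen_lt ?_ ?_).inter (isOpen_lt ?_ ?_)) <;> fun_prop

omit hd₁ hd₂ hd₃ in
theorem mem_prodNat_affineLattice (u v : ℤ) (N : ℕ) :
    ((![b 0 + u, b 1 + v], (N : ℝ)) : (Fin 2 → ℝ) × ℝ) ∈ prodNat (affineLattice b) := by
  refine ⟨⟨![u, v], ?_⟩, N, rfl⟩
  ext i
  fin_cases i <;> simp [add_comm]

theorem half_le_of_isFree (hγ₁ : 0 < γ₁) (hγ₃ : 0 < γ₃)
    (hfree : IsFree (prodNat (affineLattice b)) (pyramid b γ₁ γ₂ γ₃)) : 1 / 2 ≤ γ₂ := by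
  by_contra! h
  -- The point (b + (1, 3), 3) is strictly inside the first and third facets, and inside the second
  -- exactly when 2γ₂ < 1.
  refine (Set.eq_empty_iff_forall_notMem.1 hfree _) ⟨mem_prodNat_affineLattice 1 3 3, ?_⟩
  refine mem_interior_pyramid hd₁ hd₂ hd₃ ?_ ?_ ?_ <;> simp <;> linarith

theorem cone_condition_of_isFree (hγ₁ : 0 < γ₁) (hγ₃ : 0 < γ₃) (hγ₃' : γ₃ < 1)
    (hfree : IsFree (prodNat (affineLattice b)) (pyramid b γ₁ γ₂ γ₃)) :
    0 < γ₂ * (2 - γ₃ + 2 * γ₁ * γ₃) - γ₁ * γ₃ := by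
  have h := half_le_of_isFree hd₁ hd₂ hd₃ hγ₁ hγ₃ hfree
  have hpos := mul_pos hγ₁ hγ₃
  have := mul_le_mul_of_nonneg_right h (by linarith : 0 ≤ 2 - γ₃ + 2 * γ₁ * γ₃)
  linarith

end Triangle

/-- `ℤ²` as a subgroup of `ℝ²`. -/
def integerPoints : AddSubgroup (Fin 2 → ℝ) where
  carrier := {x | ∃ u v : ℤ, x = ![(u : ℝ), (v : ℝ)]}
  zero_mem' := ⟨0, 0, by ext i; fin_cases i <;> simp⟩
  add_mem' := by
    rintro _ _ ⟨u, v, rfl⟩ ⟨u', v', rfl⟩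
    exact ⟨u + u', v + v', by ext i; fin_cases i <;> simp⟩
  neg_mem' := by
    rintro _ ⟨u, v, rfl⟩
    exact ⟨-u, -v, by ext i; fin_cases i <;> simp⟩

theorem affineLattice_add_mem {b s w : Fin 2 → ℝ} (hs : s ∈ affineLattice b)
    (hw : w ∈ integerPoints) : s + w ∈ affineLattice b := by
  obtain ⟨z, rfl⟩ := hs
  obtain ⟨u, v, rfl⟩ := hw
  refine ⟨z + ![u, v], ?_⟩
  ext i
  fin_cases i <;> simp <;> ring

/-! ### The covering by slices and its consequences -/

section Cover
variable {b p : Fin 2 → ℝ} {γ₁ γ₂ γ₃ t : ℝ}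

/-- A triangle contains finitely many points of a translate of `ℤ²`. -/
theorem finite_integer_points_triangle (hγ₁ : 0 < γ₁) (hγ₂ : 0 < γ₂) (hγ₃ : 0 < γ₃)
    (hγ₂' : γ₂ < 1) (hγ₃' : γ₃ < 1) (x₀ y₀ c₁ c₂ c₃ : ℝ) :
    {w : ℤ × ℤ | x₀ + w.1 + γ₁ * (y₀ + w.2) ≤ c₁ ∧ -(x₀ + w.1) + γ₂ * (y₀ + w.2) ≤ c₂ ∧
      γ₃ * (x₀ + w.1) - (y₀ + w.2) ≤ c₃}.Finite := by
  have hγ : 0 < 1 - γ₂ * γ₃ := by nlinarith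
  set l := (-(γ₃ * c₂) - c₃) / (1 - γ₂ * γ₃) with hl
  set u := (c₁ + c₂) / (γ₁ + γ₂) with hu
  refine ((Set.finite_Icc ⌈γ₂ * l - c₂ - x₀⌉ ⌊c₁ - γ₁ * l - x₀⌋).prod
    (Set.finite_Icc ⌈l - y₀⌉ ⌊u - y₀⌋)).subset ?_
  rintro ⟨m, n⟩ ⟨h₁, h₂, h₃⟩
  simp only at h₁ h₂ h₃
  have hyl : l ≤ y₀ + n := by
    rw [hl, div_le_iff₀ hγ]
    linarith [mul_le_mul_of_nonneg_left h₂ hγ₃.le]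
  have hyu : y₀ + n ≤ u := by
    rw [hu, le_div_iff₀ (by positivity)]
    linarith
  have := mul_le_mul_of_nonneg_left hyl hγ₁.le
  have := mul_le_mul_of_nonneg_left hyl hγ₂.le
  refine ⟨⟨Int.ceil_le.2 ?_, Int.le_floor.2 ?_⟩, ⟨Int.ceil_le.2 ?_, Int.le_floor.2 ?_⟩⟩ <;>
    linarith

variable (hd₁ : 0 < 1 + γ₁ + b 0 + γ₁ * b 1) (hd₂ : 0 < γ₂ - b 0 + γ₂ * b 1)
  (hd₃ : 0 < γ₃ * b 0 - b 1)

include hd₁ hd₂ hd₃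

/-- Sublevel sets are finite, being lattice points of triangles, so the minimum is attained. -/
theorem exists_forall_psi_omega_le (hγ₁ : 0 < γ₁) (hγ₂ : 0 < γ₂) (hγ₃ : 0 < γ₃)
    (hγ₂' : γ₂ < 1) (hγ₃' : γ₃ < 1) (p q : Fin 2 → ℝ) (t : ℝ) :
    ∃ (m n : ℤ) (i : Fin 2), ∀ (m' n' : ℤ) (i' : Fin 2),
      psi (omega b γ₁ γ₂ γ₃) (q + ![(m : ℝ), n] - ((i : ℕ) : ℝ) • p) + (i : ℕ) * t ≤
      psi (omega b γ₁ γ₂ γ₃) (q + ![(m' : ℝ), n'] - ((i' : ℕ) : ℝ) • p) + (i' : ℕ) * t := by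
  have htend : Filter.Tendsto (fun w : (ℤ × ℤ) × Fin 2 => psi (omega b γ₁ γ₂ γ₃)
      (q + ![(w.1.1 : ℝ), w.1.2] - ((w.2 : ℕ) : ℝ) • p) + (w.2 : ℕ) * t)
      Filter.cofinite Filter.atTop := by
    rw [Filter.tendsto_atTop]
    intro c
    rw [Filter.eventually_cofinite]
    have hfin (i : Fin 2) := finite_integer_points_triangle hγ₁ hγ₂ hγ₃ hγ₂' hγ₃'
      (q 0 - (i : ℕ) * p 0) (q 1 - (i : ℕ) * p 1)
      ((c - (i : ℕ) * t) * (1 + γ₁ + b 0 + γ₁ * b 1))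
      ((c - (i : ℕ) * t) * (γ₂ - b 0 + γ₂ * b 1)) ((c - (i : ℕ) * t) * (γ₃ * b 0 - b 1))
    refine (Set.finite_iUnion fun i => (hfin i).prod (Set.finite_singleton i)).subset ?_
    rintro ⟨⟨m, n⟩, i⟩ hw
    have h : psi (omega b γ₁ γ₂ γ₃) (q + ![(m : ℝ), n] - ((i : ℕ) : ℝ) • p) ≤
        c - (i : ℕ) * t := by
      have := not_le.1 hw
      simp only at this
      linarith
    obtain ⟨h₁, h₂, h₃⟩ := (psi_omega_le_iff hd₁ hd₂ hd₃ _ _).1 h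
    simp only [Pi.sub_apply, Pi.add_apply, Pi.smul_apply, smul_eq_mul, Matrix.cons_val_zero,
      Matrix.cons_val_one] at h₁ h₂ h₃
    refine Set.mem_iUnion.2 ⟨i, ⟨?_, ?_, ?_⟩, rfl⟩ <;> simp only <;> linarith
  obtain ⟨⟨⟨m, n⟩, i⟩, h⟩ := htend.exists_forall_le
  exact ⟨m, n, i, fun m' n' i' => h ((m', n'), i')⟩

variable (hp : t * (1 + γ₁ + b 0 + γ₁ * b 1) = p 0 + γ₁ * p 1 - γ₁ ∧
  t * (γ₂ - b 0 + γ₂ * b 1) = -p 0 + γ₂ * p 1 ∧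
  t * (γ₃ * b 0 - b 1) = γ₃ * p 0 - p 1 + (1 - γ₃ / 2))

include hp

theorem psi_omega_sub_add_le_iff (r : Fin 2 → ℝ) (N c : ℝ) :
    psi (omega b γ₁ γ₂ γ₃) (r - N • p) + N * t ≤ c ↔
    r 0 + γ₁ * r 1 - γ₁ * N ≤ c * (1 + γ₁ + b 0 + γ₁ * b 1) ∧
    -r 0 + γ₂ * r 1 ≤ c * (γ₂ - b 0 + γ₂ * b 1) ∧
    γ₃ * r 0 - r 1 + (1 - γ₃ / 2) * N ≤ c * (γ₃ * b 0 - b 1) := by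
  obtain ⟨h₁, h₂, h₃⟩ := hp
  rw [← le_sub_iff_add_le, psi_omega_le_iff hd₁ hd₂ hd₃]
  simp only [Pi.sub_apply, Pi.smul_apply, smul_eq_mul, sub_mul, mul_assoc, h₁, h₂, h₃]
  refine and_congr ?_ (and_congr ?_ ?_) <;> constructor <;> intro h <;> linarith

theorem exists_tight_representation (hγ₁ : 0 < γ₁) (hγ₂ : 0 < γ₂) (hγ₃ : 0 < γ₃)
    (hγ₂' : γ₂ < 1) (hγ₃' : γ₃ < 1) (q : Fin 2 → ℝ) :
    ∃ w ∈ integerPoints, ∃ i j : ℕ, ∃ x ∈ affineLattice b,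
      psi (omega b γ₁ γ₂ γ₃) (q + w - (i : ℝ) • p) + i * t +
        (psi (omega b γ₁ γ₂ γ₃) (x - (q + w) - (j : ℝ) • p) + j * t) ≤ 1 := by
  obtain ⟨m, n, i, hmin⟩ := exists_forall_psi_omega_le hd₁ hd₂ hd₃ hγ₁ hγ₂ hγ₃ hγ₂' hγ₃' p q t
  obtain ⟨m', n', j, hmin'⟩ :=
    exists_forall_psi_omega_le hd₁ hd₂ hd₃ hγ₁ hγ₂ hγ₃ hγ₂' hγ₃' p (b - q) t
  refine ⟨![(m : ℝ), n], ⟨m, n, rfl⟩, i, j, b + ![(m : ℝ), n] + ![(m' : ℝ), n'],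
    affineLattice_add_mem (affineLattice_add_mem ⟨0, by simp [← Pi.zero_def]⟩ ⟨m, n, rfl⟩)
      ⟨m', n', rfl⟩, ?_⟩
  rw [show b + ![(m : ℝ), n] + ![(m' : ℝ), n'] - (q + ![(m : ℝ), n]) = b - q + ![(m' : ℝ), n'] by
    abel, ← le_sub_iff_add_le]
  -- Any `c` below the first minimum must not exceed 1 minus the second: the slices scaled by `c`
  -- and by `1 - c` cover the plane, and the first alternative is excluded.
  refine le_of_forall_lt_imp_le_of_dense fun c hc => ?_
  rcases slices_cover (γ₁ := γ₁) hγ₂ hγ₃ hγ₂' hγ₃' c (q 0 - c * b 0) (q 1 - c * b 1) with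
    ⟨u, v, k, h₁, h₂, h₃⟩ | ⟨u, v, k, h₁, h₂, h₃⟩
  · refine absurd (hmin u (v + (k : ℕ)) k) (not_le.2 (lt_of_le_of_lt ?_ hc))
    rw [psi_omega_sub_add_le_iff hd₁ hd₂ hd₃ hp]
    simp
    refine ⟨?_, ?_, ?_⟩ <;> linarith
  · have h : psi (omega b γ₁ γ₂ γ₃) (b - q + ![((-u : ℤ) : ℝ), (((k : ℕ) - v : ℤ) : ℝ)]
        - ((k : ℕ) : ℝ) • p) + (k : ℕ) * t ≤ 1 - c := by
      rw [psi_omega_sub_add_le_iff hd₁ hd₂ hd₃ hp]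
      simp
      refine ⟨?_, ?_, ?_⟩ <;> linarith
    linarith [hmin' _ _ _ |>.trans h]

theorem one_le_of_isFree (hfree : IsFree (prodNat (affineLattice b)) (pyramid b γ₁ γ₂ γ₃))
    (x : Fin 2 → ℝ) (hx : x ∈ affineLattice b) (N : ℕ) :
    1 ≤ psi (omega b γ₁ γ₂ γ₃) (x - (N : ℝ) • p) + N * t := by
  by_contra! h
  obtain ⟨c, hc, hc'⟩ := exists_between h
  obtain ⟨h₁, h₂, h₃⟩ := (psi_omega_sub_add_le_iff hd₁ hd₂ hd₃ hp _ _ _).1 hc.le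
  refine (Set.eq_empty_iff_forall_notMem.1 hfree (x, (N : ℝ))) ⟨⟨hx, N, rfl⟩, ?_⟩
  exact mem_interior_pyramid hd₁ hd₂ hd₃ (h₁.trans_lt (mul_lt_of_lt_one_left hd₁ hc'))
    (h₂.trans_lt (mul_lt_of_lt_one_left hd₂ hc')) (h₃.trans_lt (mul_lt_of_lt_one_left hd₃ hc'))

theorem exists_tight_point (hγ₂' : γ₂ < 1) (hγ₃' : γ₃ < 1) :
    ∃ x ∈ affineLattice b, ∃ N : ℕ, 0 < N ∧
      psi (omega b γ₁ γ₂ γ₃) (x - (N : ℝ) • p) + N * t ≤ 1 := by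
  -- The first facet passes through (b + (1, 2), 1); the other two inequalities hold because γ₂, γ₃
  -- < 1.
  refine ⟨_, (mem_prodNat_affineLattice 1 2 1).1, 1, one_pos, ?_⟩
  rw [psi_omega_sub_add_le_iff hd₁ hd₂ hd₃ hp]
  simp
  refine ⟨?_, ?_, ?_⟩ <;> linarith

end Cover

end CutGen

theorem mainTheorem3 (b : Fin 2 → ℝ) (γ₁ γ₂ γ₃ : ℝ)
    (hb : ¬ ∃ z : Fin 2 → ℤ, b = fun i => (z i : ℝ))
    (hb₁ : -1 ≤ b 1) (hb₂ : b 1 ≤ b 0) (hb₃ : b 0 ≤ 0)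
    (hγ₁ : 0 < γ₁) (hγ₂ : 0 < γ₂) (hγ₃ : 0 < γ₃) (hγ₂' : γ₂ < 1) (hγ₃' : γ₃ < 1) :
    ((∃ v, CutGen.IsTranslatedCone (CutGen.pyramid b γ₁ γ₂ γ₃) v ∧ 0 < v.2) ↔
      0 < γ₂ * (2 - γ₃ + 2 * γ₁ * γ₃) - γ₁ * γ₃) ∧
    (CutGen.IsFree (CutGen.prodNat (CutGen.affineLattice b)) (CutGen.pyramid b γ₁ γ₂ γ₃) →
      ∃ v, CutGen.IsTranslatedCone (CutGen.pyramid b γ₁ γ₂ γ₃) v ∧ 0 < v.2 ∧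
        CutGen.fixedUnion (CutGen.affineLattice b) (CutGen.omega b γ₁ γ₂ γ₃) ((1 / v.2) • v.1)
          + CutGen.translationLattice (CutGen.affineLattice b) = Set.univ ∧
        (∃! π, π ∈ CutGen.liftingSet (CutGen.affineLattice b)
          (CutGen.psi (CutGen.omega b γ₁ γ₂ γ₃)) ((1 / v.2) • v.1)) ∧
        CutGen.fixingRegion (CutGen.affineLattice b)
          (CutGen.psi (CutGen.omega b γ₁ γ₂ γ₃)) ((1 / v.2) • v.1) = Set.univ) := by
  obtain ⟨hd₁, hd₂, hd₃⟩ := CutGen.denominators_pos hb hb₁ hb₂ hb₃ hγ₁ hγ₂ hγ₃'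
  have hi := CutGen.exists_isTranslatedCone_iff hd₁ hd₂ hd₃ hγ₁ hγ₂ hγ₃ hγ₂' hγ₃'
  refine ⟨hi, fun hfree => ?_⟩
  have hD := CutGen.cone_condition_of_isFree hd₁ hd₂ hd₃ hγ₁ hγ₃ hγ₃' hfree
  obtain ⟨v, hv, hv0⟩ := hi.2 hD
  obtain ⟨a, ha⟩ := CutGen.exists_apex (b := b) hD.ne' (by positivity)
  obtain ⟨h₁, h₂, h₃⟩ := CutGen.facets_eq_of_isTranslatedCone hd₁ hd₂ hd₃ hv ha
  have hp : 1 / v.2 * (1 + γ₁ + b 0 + γ₁ * b 1) =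
        ((1 / v.2) • v.1) 0 + γ₁ * ((1 / v.2) • v.1) 1 - γ₁ ∧
      1 / v.2 * (γ₂ - b 0 + γ₂ * b 1) = -((1 / v.2) • v.1) 0 + γ₂ * ((1 / v.2) • v.1) 1 ∧
      1 / v.2 * (γ₃ * b 0 - b 1) =
        γ₃ * ((1 / v.2) • v.1) 0 - ((1 / v.2) • v.1) 1 + (1 - γ₃ / 2) := by
    rw [← h₁, ← h₂, ← h₃]
    simp only [Pi.smul_apply, smul_eq_mul]
    refine ⟨?_, ?_, ?_⟩ <;> field_simp
  have hL : ∀ s ∈ CutGen.affineLattice b, ∀ w ∈ CutGen.integerPoints,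
      s + w ∈ CutGen.affineLattice b := fun s hs w hw => CutGen.affineLattice_add_mem hs hw
  have hone := CutGen.one_le_of_isFree hd₁ hd₂ hd₃ hp hfree
  have htight := CutGen.exists_tight_point hd₁ hd₂ hd₃ hp hγ₂' hγ₃'
  have hcover := CutGen.exists_tight_representation hd₁ hd₂ hd₃ hp hγ₁ hγ₂ hγ₃ hγ₂' hγ₃'
  have hunique := (CutGen.V_eq_and_existsUnique hL hone htight hcover).2
  exact ⟨v, hv, hv0, CutGen.fixedUnion_add_translationLattice hL hone htight hcover, hunique,
    CutGen.fixingRegion_eq_univ_of_existsUnique hunique⟩
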